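/- Let $\alpha\in(0,\infty)\setminus\mathbb{N}$, let $n=[\alpha]+1$, where $[\alpha]$ is the integer part of $\alpha$, and let $T>0$. For a function $x:(0,\infty)\to\mathbb{R}$ and $t>0$ put $$^{RL}D^{\alpha}x(t)=\frac{1}{\Gamma(n-\alpha)}\Big(\frac{d}{dt}\Big)^{n}\int_0^t(t-s)^{n-\alpha-1}x(s)\,ds,\qquad {}^{C}D^{\alpha}x(t)=\frac{1}{\Gamma(n-\alpha)}\int_0^t(t-s)^{n-\alpha-1}x^{(n)}(s)\,ds,$$ $$^{GL}D^{\alpha}x(t)=\lim_{h\to0^+}h^{-\alpha}\sum_{r=0}^{[t/h]}(-1)^r\binom{\alpha}{r}x(t-rh)$$ (the Riemann–Liouville, Caputo and Grünwald–Letnikov derivatives of order $\alpha$ of $x$), where $x(0)$, which enters the last sum when $t/h$ is an integer, is given an arbitrary real value. A function $f$ on $(0,\infty)$ is called $T$-periodic if $f(t+T)=f(t)$ for all $t>0$. Let $x:(0,\infty)\to\mathbb{R}$ be a non-constant $T$-periodic function of class $C^n$ on $(0,\infty)$. Then: 1. The integral $\int_0^t(t-s)^{n-\alpha-1}x(s)\,ds$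 is of class $C^n$ on $(0,\infty)$, so that $^{RL}D^{\alpha}x$ exists on $(0,\infty)$, and $^{RL}D^{\alpha}x$ is not $T$-periodic. 2. The limit $^{GL}D^{\alpha}x(t)$ exists and equals $^{RL}D^{\alpha}x(t)$ for every $t>0$, and $^{GL}D^{\alpha}x$ is not $T$-periodic. 3. The limits $x^{(k)}(0^+)=\lim_{t\to0^+}x^{(k)}(t)$, $0\le k\le n-1$, exist. If at least one of them is non-zero, then $\lim_{t\to0^+}{}^{RL}D^{\alpha}x(t)$ is $+\infty$ or $-\infty$. If all of them are zero, then $^{RL}D^{\alpha}x(t)={}^{C}D^{\alpha}x(t)$ for every $t>0$, and $^{C}D^{\alpha}x$ is not $T$-periodic. -/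

import Mathlib

open Filter Topology Set

noncomputable section

namespace FracDeriv

/-- The integer `n = [α] + 1` attached to an order `α > 0`. -/
def ord (α : ℝ) : ℕ := ⌊α⌋₊ + 1

/-- The integral `∫ₐᵗ (t - s)^(n - α - 1) g(s) ds`, with `n = [α] + 1`. -/
def kernelIntegral (a α : ℝ) (g : ℝ → ℝ) (t : ℝ) : ℝ :=
  ∫ s in a..t, (t - s) ^ ((ord α : ℝ) - α - 1) * g s

/-- The Riemann–Liouville derivative of order `α` of `g`, based at `a`. -/
def rlDeriv (a α : ℝ) (g : ℝ → ℝ) (t : ℝ) : ℝ :=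
  1 / Real.Gamma ((ord α : ℝ) - α) * iteratedDeriv (ord α) (kernelIntegral a α g) t

/-- The Caputo derivative of order `α` of `g`, based at `a`. -/
def caputoDeriv (a α : ℝ) (g : ℝ → ℝ) (t : ℝ) : ℝ :=
  1 / Real.Gamma ((ord α : ℝ) - α) * kernelIntegral a α (iteratedDeriv (ord α) g) t

/-- The Grünwald–Letnikov difference quotient of step `h > 0`; `Ring.choose α r` is the
generalized binomial coefficient `α (α - 1) ⋯ (α - r + 1) / r!`. -/
def glQuotient (a α : ℝ) (g : ℝ → ℝ) (t h : ℝ) : ℝ :=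
  h ^ (-α) * ∑ r ∈ Finset.range (⌊(t - a) / h⌋₊ + 1),
    (-1 : ℝ) ^ r * Ring.choose α r * g (t - r * h)

/-- `L` is the Grünwald–Letnikov derivative of order `α` of `g` at `t`, based at `a`. -/
def HasGLDerivAt (a α : ℝ) (g : ℝ → ℝ) (L t : ℝ) : Prop :=
  Tendsto (glQuotient a α g t) (𝓝[>] 0) (𝓝 L)

/-- The Grünwald–Letnikov derivative as a function (meaningful where the limit exists). -/
def glDeriv (a α : ℝ) (g : ℝ → ℝ) (t : ℝ) : ℝ :=
  limUnder (𝓝[>] 0) (glQuotient a α g t)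

/-- `f`, regarded as a function on `(0, ∞)`, is `T`-periodic. -/
def PeriodicOnPos (T : ℝ) (f : ℝ → ℝ) : Prop :=
  ∀ t, 0 < t → f (t + T) = f t

end FracDeriv

end

namespace FracDeriv

open MeasureTheory

/-! Let `n = ord α`. By periodicity `x` extends to a periodic `C^n` function `y` on `ℝ`, so the
derivatives of `y` up to order `n` are bounded and have values at `0`. Differentiating the
convolution `n` times gives `rlDeriv_eq`: the Riemann–Liouville derivative is the Caputo derivative
plus the terms `y^(k)(0) t^(k-α) / Γ(k+1-α)`, `k < n`. The Caputo part tends to `0` at `0⁺` and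
every `k - α` is negative, so the first non-zero `y^(k)(0)` forces blow-up.

If the Riemann–Liouville derivative were periodic, its limit at `0⁺` would be its finite value at
`T`; hence all `y^(k)(0)` vanish and only the Caputo part remains. Put `z = y^(n)` and `γ = n - α -
1 ∈ (-1, 0)`. The increment of the convolution over one period is `∫₀ᵀ (t+u)^γ z(-u) du`, which is
then zero for all `t > 0`. Differentiating in `t` and setting `t = 1` makes `(1+u)^γ z(-u)`
orthogonal to all polynomials in `1/(1+u)`, so Weierstrass approximation gives `z = 0`. With zero
initial values `y = 0`, which contradicts non-constancy.

For the Grünwald–Letnikov derivative, `n` summations by parts split the sum into boundary terms,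
which tend to the singular terms by Euler's limit for `Γ`, and a weakly singular Riemann sum, which
tends to the Caputo part by dominated convergence. -/

/-! ### Differentiating a convolution with a power -/

/-- Convolution on `[0, t]` with the power `u ^ γ`. -/
noncomputable def powConv (γ : ℝ) (g : ℝ → ℝ) (t : ℝ) : ℝ :=
  ∫ u in (0 : ℝ)..t, u ^ γ * g (t - u)

theorem kernelIntegral_eq_powConv (α : ℝ) (g : ℝ → ℝ) (t : ℝ) :
    kernelIntegral 0 α g t = powConv ((ord α : ℝ) - α - 1) g t := by
  have h := intervalIntegral.integral_comp_sub_left (a := 0) (b := t)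
    (fun u : ℝ => u ^ ((ord α : ℝ) - α - 1) * g (t - u)) t
  simp only [sub_sub_cancel, sub_self, sub_zero] at h
  exact h

theorem intervalIntegrable_rpow_mul {γ : ℝ} (hγ : -1 < γ) {g : ℝ → ℝ} (hg : Continuous g)
    (a b : ℝ) : IntervalIntegrable (fun u => u ^ γ * g u) volume a b :=
  (intervalIntegral.intervalIntegrable_rpow' hγ).mul_continuousOn hg.continuousOn

theorem integral_indicator_Iio {c M : ℝ} (hc : 0 ≤ c) (hcM : c ≤ M) (f : ℝ → ℝ) :
    ∫ u in (0 : ℝ)..M, (Iio c).indicator f u = ∫ u in (0 : ℝ)..c, f u := by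
  rw [intervalIntegral.integral_of_le (hc.trans hcM), setIntegral_indicator measurableSet_Iio,
    intervalIntegral.integral_of_le hc, integral_Ioc_eq_integral_Ioo]
  congr 2
  ext u
  simp only [mem_inter_iff, mem_Ioc, mem_Iio, mem_Ioo]
  constructor
  · rintro ⟨⟨h1, -⟩, h2⟩
    exact ⟨h1, h2⟩
  · rintro ⟨h1, h2⟩
    exact ⟨⟨h1, by linarith⟩, h2⟩

/-- Subtracting `g 0` and clamping the argument at `0` makes the integrand vanish for `u ≥ t`. The
upper limit can then be frozen, leaving `t` only inside the integrand. -/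
theorem powConv_eq_const_add {γ : ℝ} (hγ : -1 < γ) {g : ℝ → ℝ} (hg : Continuous g) {t M : ℝ}
    (ht : 0 ≤ t) (htM : t ≤ M) :
    powConv γ g t = g 0 * (t ^ (γ + 1) / (γ + 1)) +
      ∫ u in (0 : ℝ)..M, u ^ γ * (g (max (t - u) 0) - g 0) := by
  have hc : Continuous fun u : ℝ => g (max (t - u) 0) - g 0 := by fun_prop
  have hi := intervalIntegrable_rpow_mul hγ hc
  rw [← intervalIntegral.integral_add_adjacent_intervals (hi 0 t) (hi t M)]
  have h2 : ∫ u in t..M, u ^ γ * (g (max (t - u) 0) - g 0) = 0 := by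
    rw [← intervalIntegral.integral_zero (a := t) (b := M)]
    refine intervalIntegral.integral_congr fun u hu => ?_
    rw [uIcc_of_le htM] at hu
    simp [max_eq_right (sub_nonpos.2 hu.1)]
  have h1 : t ^ (γ + 1) / (γ + 1) = ∫ u in (0 : ℝ)..t, u ^ γ := by
    rw [integral_rpow (Or.inl hγ), Real.zero_rpow (by linarith), sub_zero]
  rw [h2, h1, add_zero, ← intervalIntegral.integral_const_mul,
    ← intervalIntegral.integral_add
      ((intervalIntegral.intervalIntegrable_rpow' hγ).const_mul _) (hi 0 t)]
  refine intervalIntegral.integral_congr fun u hu => ?_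
  rw [uIcc_of_le ht] at hu
  simp only [max_eq_left (sub_nonneg.2 hu.2)]
  ring

theorem hasDerivAt_powConv {γ : ℝ} (hγ : -1 < γ) {g : ℝ → ℝ} (hg : Differentiable ℝ g)
    (hg' : Continuous (deriv g)) {B : ℝ} (hB : ∀ s, |deriv g s| ≤ B) {t : ℝ} (ht : 0 < t) :
    HasDerivAt (powConv γ g) (g 0 * t ^ γ + powConv γ (deriv g) t) t := by
  have hB0 : 0 ≤ B := (abs_nonneg _).trans (hB 0)
  have hlip : ∀ a b : ℝ, |g a - g b| ≤ B * |a - b| := fun a b =>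
    Convex.norm_image_sub_le_of_norm_deriv_le (fun x _ => hg x) (fun x _ => hB x) convex_univ
      (mem_univ b) (mem_univ a)
  have hK : powConv γ g =ᶠ[𝓝 t] fun τ => g 0 * (τ ^ (γ + 1) / (γ + 1)) +
      ∫ u in (0 : ℝ)..(t + 1), u ^ γ * (g (max (τ - u) 0) - g 0) := by
    filter_upwards [Ioo_mem_nhds ht (lt_add_one t)] with τ hτ
    exact powConv_eq_const_add hγ hg.continuous hτ.1.le hτ.2.le
  refine HasDerivAt.congr_of_eventuallyEq ?_ hK
  refine HasDerivAt.add ?_ ?_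
  · have h := (Real.hasDerivAt_rpow_const (x := t) (p := γ + 1) (Or.inl ht.ne')).div_const (γ + 1)
    refine (h.const_mul (g 0)).congr_deriv ?_
    have : γ + 1 ≠ 0 := by linarith
    rw [add_sub_cancel_right]
    field_simp
  · have hderiv : Continuous fun u : ℝ => deriv g (t - u) := by fun_prop
    have key := intervalIntegral.hasDerivAt_integral_of_dominated_loc_of_lip (μ := volume)
      (F := fun τ u => u ^ γ * (g (max (τ - u) 0) - g 0)) (x₀ := t) (s := univ)
      (F' := (Iio t).indicator fun u => u ^ γ * deriv g (t - u)) (a := 0) (b := t + 1)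
      (bound := fun u => B * |u ^ γ|) univ_mem
      (Eventually.of_forall fun τ => ((intervalIntegrable_rpow_mul hγ
        (g := fun u => g (max (τ - u) 0) - g 0) (by
          have := hg.continuous
          fun_prop) 0 (t + 1)).def').aestronglyMeasurable)
      (intervalIntegrable_rpow_mul hγ (g := fun u => g (max (t - u) 0) - g 0) (by
          have := hg.continuous
          fun_prop) 0 (t + 1))
      (((intervalIntegrable_rpow_mul hγ hderiv 0 (t + 1)).def').aestronglyMeasurable.indicator
        measurableSet_Iio)
      (Eventually.of_forall fun u _ => ?_)
      ((intervalIntegral.intervalIntegrable_rpow' hγ).abs.const_mul B)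
      ?_
    · refine key.2.congr_deriv ?_
      exact integral_indicator_Iio ht.le (by linarith) _
    · refine LipschitzOnWith.of_dist_le_mul fun a _ b _ => ?_
      rw [Real.dist_eq, Real.dist_eq, ← mul_sub, abs_mul, sub_sub_sub_cancel_right,
        Real.coe_nnabs, abs_mul, abs_abs, abs_of_nonneg hB0]
      have h1 := hlip (max (a - u) 0) (max (b - u) 0)
      have h2 : |max (a - u) 0 - max (b - u) 0| ≤ |a - b| := by
        refine (abs_max_sub_max_le_abs _ _ _).trans (le_of_eq ?_)
        congr 1; ring
      calc |u ^ γ| * |g (max (a - u) 0) - g (max (b - u) 0)|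
          ≤ |u ^ γ| * (B * |a - b|) := by gcongr; exact h1.trans (by gcongr)
        _ = B * |u ^ γ| * |a - b| := by ring
    -- The kink of `max (τ - u) 0` at `τ = t` occurs only for `u = t`, a null set.
    · have hne : ∀ᵐ u : ℝ ∂volume, u ≠ t := by simp [ae_iff]
      filter_upwards [hne] with u hu _
      rcases lt_or_gt_of_ne hu with h | h
      · rw [indicator_of_mem (show u ∈ Iio t from h)]
        have hd : HasDerivAt (fun τ => g (τ - u) - g 0) (deriv g (t - u)) t := by
          have := (hg (t - u)).hasDerivAt.comp_sub_const t u
          exact this.sub_const _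
        refine (hd.const_mul (u ^ γ)).congr_of_eventuallyEq ?_
        filter_upwards [Ioi_mem_nhds h] with τ hτ
        rw [max_eq_left (sub_nonneg.2 (le_of_lt hτ))]
      · rw [indicator_of_notMem (show u ∉ Iio t from not_lt.2 h.le)]
        refine (hasDerivAt_const t (0 : ℝ)).congr_of_eventuallyEq ?_
        filter_upwards [Iio_mem_nhds h] with τ hτ
        rw [max_eq_right (sub_nonpos.2 (le_of_lt hτ))]
        simp

theorem powConv_eq_scaled {γ : ℝ} (g : ℝ → ℝ) {t : ℝ} (ht : 0 < t) :
    powConv γ g t = t ^ (γ + 1) * ∫ v in (0 : ℝ)..1, v ^ γ * g (t - t * v) := by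
  have h := intervalIntegral.smul_integral_comp_mul_left (a := 0) (b := 1)
    (fun u : ℝ => u ^ γ * g (t - u)) t
  simp only [mul_zero, mul_one, smul_eq_mul] at h
  rw [powConv, ← h, Real.rpow_add ht, Real.rpow_one, mul_comm (t ^ γ) t, mul_assoc,
    ← intervalIntegral.integral_const_mul (t ^ γ)]
  congr 1
  refine intervalIntegral.integral_congr fun v hv => ?_
  rw [uIcc_of_le zero_le_one] at hv
  simp only [Real.mul_rpow ht.le hv.1]
  ring

theorem continuousOn_powConv {γ : ℝ} (hγ : -1 < γ) {g : ℝ → ℝ} (hg : Continuous g)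
    {B : ℝ} (hB : ∀ s, |g s| ≤ B) : ContinuousOn (powConv γ g) (Ioi 0) := by
  have h : Continuous fun t : ℝ => ∫ v in (0 : ℝ)..1, v ^ γ * g (t - t * v) := by
    refine intervalIntegral.continuous_of_dominated_interval (bound := fun v => |v ^ γ| * B)
      (fun t => ((intervalIntegrable_rpow_mul hγ (g := fun v => g (t - t * v))
        (by fun_prop) 0 1).def').aestronglyMeasurable)
      (fun t => Eventually.of_forall fun v _ => ?_)
      ((intervalIntegral.intervalIntegrable_rpow' hγ).abs.mul_const B)
      (Eventually.of_forall fun v _ => by fun_prop)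
    rw [Real.norm_eq_abs, abs_mul]
    gcongr
    exact hB _
  refine ContinuousOn.congr ?_ fun t ht => powConv_eq_scaled g ht
  refine ContinuousOn.mul (fun t ht => ?_) h.continuousOn
  exact (Real.continuousAt_rpow_const t _ (Or.inl (ne_of_gt ht))).continuousWithinAt

theorem abs_powConv_le {γ : ℝ} (hγ : -1 < γ) {g : ℝ → ℝ}
    {B : ℝ} (hB : ∀ s, |g s| ≤ B) {t : ℝ} (ht : 0 ≤ t) :
    |powConv γ g t| ≤ B * (t ^ (γ + 1) / (γ + 1)) := by
  have h1 : t ^ (γ + 1) / (γ + 1) = ∫ u in (0 : ℝ)..t, u ^ γ := by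
    rw [integral_rpow (Or.inl hγ), Real.zero_rpow (by linarith), sub_zero]
  rw [h1, powConv, ← intervalIntegral.integral_const_mul, ← Real.norm_eq_abs]
  refine intervalIntegral.norm_integral_le_of_norm_le ht
    (Eventually.of_forall fun u hu => ?_)
    ((intervalIntegral.intervalIntegrable_rpow' hγ).const_mul B)
  rw [Real.norm_eq_abs, abs_mul, abs_of_nonneg (Real.rpow_nonneg hu.1.le γ), mul_comm]
  gcongr
  · exact Real.rpow_nonneg hu.1.le γ
  · exact hB _

theorem tendsto_powConv_zero {γ : ℝ} (hγ : -1 < γ) {g : ℝ → ℝ}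
    {B : ℝ} (hB : ∀ s, |g s| ≤ B) : Tendsto (powConv γ g) (𝓝[>] 0) (𝓝 0) := by
  have hlim : Tendsto (fun t : ℝ => B * (t ^ (γ + 1) / (γ + 1))) (𝓝[>] 0) (𝓝 0) := by
    have h : Tendsto (fun t : ℝ => t ^ (γ + 1)) (𝓝 0) (𝓝 0) := by
      have := (Real.continuousAt_rpow_const 0 (γ + 1) (Or.inr (by linarith))).tendsto
      rwa [Real.zero_rpow (by linarith)] at this
    simpa using ((h.mono_left nhdsWithin_le_nhds).div_const (γ + 1)).const_mul B
  refine squeeze_zero_norm' ?_ hlim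
  filter_upwards [self_mem_nhdsWithin] with t ht
  exact abs_powConv_le hγ hB (le_of_lt ht)

/-- Each differentiation passes from `g` to `deriv g` and releases a term `g 0 * t ^ γ`; the term
released at stage `k` is differentiated `j - 1 - k` more times. -/
theorem contDiffOn_and_iteratedDeriv_powConv {γ : ℝ} (hγ : -1 < γ) (j : ℕ) {g : ℝ → ℝ}
    (hg : ContDiff ℝ j g) (hB : ∀ k ≤ j, ∃ B, ∀ s, |iteratedDeriv k g s| ≤ B) :
    ContDiffOn ℝ j (powConv γ g) (Ioi 0) ∧ ∀ t, 0 < t →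
      iteratedDeriv j (powConv γ g) t = ∑ k ∈ Finset.range j, iteratedDeriv k g 0 *
        ((descPochhammer ℝ (j - 1 - k)).eval γ * t ^ (γ - (j - 1 - k : ℕ))) +
        powConv γ (iteratedDeriv j g) t := by
  induction j generalizing g with
  | zero =>
    obtain ⟨B, h⟩ := hB 0 le_rfl
    refine ⟨?_, fun t _ => by simp⟩
    simp only [iteratedDeriv_zero] at h
    exact contDiffOn_zero.2 (continuousOn_powConv hγ hg.continuous h)
  | succ j ih =>
    have hg1 : ContDiff ℝ j (deriv g) := by
      have := hg
      push_cast at this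
      exact (contDiff_succ_iff_deriv.1 this).2.2
    obtain ⟨B, hB1⟩ := hB 1 (by omega)
    rw [iteratedDeriv_one] at hB1
    have hd : ∀ t, 0 < t →
        HasDerivAt (powConv γ g) (g 0 * t ^ γ + powConv γ (deriv g) t) t := fun t ht =>
      hasDerivAt_powConv hγ (hg.differentiable (by simp)) hg1.continuous hB1 ht
    obtain ⟨ihc, ihd⟩ := ih hg1 fun k hk => by
      obtain ⟨C, hC⟩ := hB (k + 1) (by omega)
      rw [iteratedDeriv_succ'] at hC
      exact ⟨C, hC⟩
    have hpow : ContDiffOn ℝ j (fun t : ℝ => g 0 * t ^ γ) (Ioi 0) := fun t ht =>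
      (contDiffAt_const.mul
        (Real.contDiffAt_rpow_const_of_ne (ne_of_gt ht))).contDiffWithinAt
    have heq : EqOn (deriv (powConv γ g)) (fun t => g 0 * t ^ γ + powConv γ (deriv g) t)
        (Ioi 0) := fun t ht => (hd t ht).deriv
    constructor
    · push_cast
      rw [contDiffOn_succ_iff_deriv_of_isOpen isOpen_Ioi]
      refine ⟨fun t ht => (hd t ht).differentiableAt.differentiableWithinAt, by simp, ?_⟩
      exact (hpow.add ihc).congr heq
    · intro t ht
      rw [iteratedDeriv_succ', heq.iteratedDeriv_of_isOpen isOpen_Ioi j ht,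
        iteratedDeriv_fun_add (hpow.contDiffAt (Ioi_mem_nhds ht))
          (ihc.contDiffAt (Ioi_mem_nhds ht)), ihd t ht, iteratedDeriv_const_mul_field,
        iteratedDeriv_eq_iterate, Real.iter_deriv_rpow_const, Finset.sum_range_succ',
        iteratedDeriv_succ']
      simp only [iteratedDeriv_succ', iteratedDeriv_zero, Nat.add_sub_cancel, Nat.sub_zero,
        Nat.sub_sub]
      ring_nf

/-! ### Singular terms of the Riemann–Liouville derivative and blow-up at the origin -/

theorem descPochhammer_eval_mul_Gamma {s : ℝ} (m : ℕ) (hs : ∀ i < m, s ≠ (i : ℝ)) :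
    (descPochhammer ℝ m).eval s * Real.Gamma (s + 1 - m) = Real.Gamma (s + 1) := by
  induction m with
  | zero => simp
  | succ m ih =>
    rw [← ih fun i hi => hs i (by omega), descPochhammer_succ_right]
    have h := Real.Gamma_add_one (sub_ne_zero.2 (hs m (by omega)))
    rw [show s + 1 - (m : ℝ) = s - m + 1 by ring, h]
    simp only [Polynomial.eval_mul, Polynomial.eval_sub, Polynomial.eval_X,
      Polynomial.eval_natCast]
    push_cast
    rw [show s + 1 - ((m : ℝ) + 1) = s - m by ring]
    ring

theorem lt_ord (α : ℝ) : α < ord α := by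
  simpa [ord] using Nat.lt_floor_add_one α

theorem ord_sub_one_lt {α : ℝ} (hα : 0 < α) (hαN : ∀ m : ℕ, α ≠ (m : ℝ)) :
    (ord α : ℝ) - 1 < α := by
  have h := Nat.floor_le hα.le
  simp only [ord, Nat.cast_add, Nat.cast_one, add_sub_cancel_right]
  exact lt_of_le_of_ne h (hαN _).symm

theorem natCast_lt_of_lt_ord {α : ℝ} (hα : 0 < α) (hαN : ∀ m : ℕ, α ≠ (m : ℝ)) {k : ℕ}
    (hk : k < ord α) : (k : ℝ) < α := by
  have h1 : (k : ℝ) + 1 ≤ ord α := by exact_mod_cast hk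
  linarith [ord_sub_one_lt hα hαN]

theorem Gamma_natCast_add_one_sub_ne_zero {α : ℝ} (hαN : ∀ m : ℕ, α ≠ (m : ℝ)) (k : ℕ) :
    Real.Gamma ((k : ℝ) + 1 - α) ≠ 0 := by
  refine Real.Gamma_ne_zero fun m h => hαN (k + 1 + m) ?_
  push_cast
  linarith

theorem contDiffOn_kernelIntegral {α : ℝ} {g : ℝ → ℝ}
    (hg : ContDiff ℝ (ord α) g) (hB : ∀ k ≤ ord α, ∃ B, ∀ s, |iteratedDeriv k g s| ≤ B) :
    ContDiffOn ℝ (ord α) (kernelIntegral 0 α g) (Ioi 0) := by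
  rw [funext (kernelIntegral_eq_powConv α g)]
  exact (contDiffOn_and_iteratedDeriv_powConv (by linarith [lt_ord α]) _ hg hB).1

/-- The Riemann–Liouville derivative is the sum of the singular terms coming from the initial
values and of the Caputo derivative. -/
theorem rlDeriv_eq {α : ℝ} (hαN : ∀ m : ℕ, α ≠ (m : ℝ)) {g : ℝ → ℝ}
    (hg : ContDiff ℝ (ord α) g) (hB : ∀ k ≤ ord α, ∃ B, ∀ s, |iteratedDeriv k g s| ≤ B)
    {t : ℝ} (ht : 0 < t) :
    rlDeriv 0 α g t =
      ∑ k ∈ Finset.range (ord α), iteratedDeriv k g 0 *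
        (t ^ ((k : ℝ) - α) / Real.Gamma ((k : ℝ) + 1 - α)) +
      1 / Real.Gamma ((ord α : ℝ) - α) *
        powConv ((ord α : ℝ) - α - 1) (iteratedDeriv (ord α) g) t := by
  rw [rlDeriv, funext (kernelIntegral_eq_powConv α g),
    (contDiffOn_and_iteratedDeriv_powConv (by linarith [lt_ord α]) _ hg hB).2 t ht, mul_add,
    Finset.mul_sum]
  congr 1
  refine Finset.sum_congr rfl fun k hk => ?_
  rw [Finset.mem_range] at hk
  set n := ord α with hn
  have hcast : ((n - 1 - k : ℕ) : ℝ) = n - 1 - k := by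
    rw [Nat.cast_sub (by omega), Nat.cast_sub (by omega)]; simp
  -- A vanishing factor, `n - α - 1 = i`, would make `α` the natural number `n - 1 - i`.
  have hG := descPochhammer_eval_mul_Gamma (s := (n : ℝ) - α - 1) (n - 1 - k) fun i hi h => by
    apply hαN (n - 1 - i)
    rw [Nat.cast_sub (by omega), Nat.cast_sub (by omega)]
    push_cast
    linarith
  rw [hcast, show (n : ℝ) - α - 1 + 1 - (n - 1 - k) = k + 1 - α by ring, sub_add_cancel] at hG
  rw [hcast, show (n : ℝ) - α - 1 - (n - 1 - k) = k - α by ring, ← hG]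
  have h1 := Gamma_natCast_add_one_sub_ne_zero hαN k
  have h2 : Real.Gamma ((n : ℝ) - α) ≠ 0 :=
    (Real.Gamma_pos_of_pos (by linarith [lt_ord α])).ne'
  rw [← hG] at h2
  have h3 := left_ne_zero_of_mul h2
  field_simp

theorem caputoDeriv_eq (α : ℝ) (g : ℝ → ℝ) (t : ℝ) :
    caputoDeriv 0 α g t = 1 / Real.Gamma ((ord α : ℝ) - α) *
        powConv ((ord α : ℝ) - α - 1) (iteratedDeriv (ord α) g) t := by
  rw [caputoDeriv, kernelIntegral_eq_powConv]

/-- If some initial value is non-zero, the Riemann–Liouville derivative blows up at `0⁺`. -/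
theorem tendsto_rlDeriv_atTop_or_atBot {α : ℝ} (hα : 0 < α) (hαN : ∀ m : ℕ, α ≠ (m : ℝ))
    {g : ℝ → ℝ} (hg : ContDiff ℝ (ord α) g)
    (hB : ∀ k ≤ ord α, ∃ B, ∀ s, |iteratedDeriv k g s| ≤ B)
    (hne : ∃ k < ord α, iteratedDeriv k g 0 ≠ 0) :
    Tendsto (rlDeriv 0 α g) (𝓝[>] 0) atTop ∨ Tendsto (rlDeriv 0 α g) (𝓝[>] 0) atBot := by
  classical
  set k₀ := Nat.find hne with hk₀
  obtain ⟨hlt, hne0⟩ := Nat.find_spec hne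
  rw [← hk₀] at hlt hne0
  have hmin : ∀ k < k₀, iteratedDeriv k g 0 = 0 := fun k hk => by
    by_contra h
    exact Nat.find_min hne hk ⟨hk.trans hlt, h⟩
  set A := iteratedDeriv k₀ g 0 / Real.Gamma ((k₀ : ℝ) + 1 - α) with hA
  have hA0 : A ≠ 0 := div_ne_zero hne0 (Gamma_natCast_add_one_sub_ne_zero hαN k₀)
  -- the quotient by the most singular power tends to its coefficient
  have hpow : ∀ p : ℝ, 0 < p → Tendsto (fun t : ℝ => t ^ p) (𝓝[>] 0) (𝓝 0) := fun p hp => by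
    have := (Real.continuousAt_rpow_const 0 p (Or.inr hp.le)).tendsto
    rw [Real.zero_rpow hp.ne'] at this
    exact this.mono_left nhdsWithin_le_nhds
  have hk₀α := natCast_lt_of_lt_ord hα hαN hlt
  obtain ⟨B, hBn⟩ := hB _ le_rfl
  have hlim : Tendsto (fun t : ℝ => ∑ k ∈ Finset.range (ord α), iteratedDeriv k g 0 *
        (t ^ ((k : ℝ) - k₀) / Real.Gamma ((k : ℝ) + 1 - α)) + t ^ (α - k₀) *
      (1 / Real.Gamma ((ord α : ℝ) - α) *
        powConv ((ord α : ℝ) - α - 1) (iteratedDeriv (ord α) g) t)) (𝓝[>] 0) (𝓝 A) := by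
    have hz := (hpow (α - k₀) (by linarith)).mul
      ((tendsto_powConv_zero (γ := (ord α : ℝ) - α - 1) (by linarith [lt_ord α]) hBn).const_mul
        (1 / Real.Gamma ((ord α : ℝ) - α)))
    have hs : Tendsto (fun t : ℝ => ∑ k ∈ Finset.range (ord α), iteratedDeriv k g 0 *
        (t ^ ((k : ℝ) - k₀) / Real.Gamma ((k : ℝ) + 1 - α))) (𝓝[>] 0)
        (𝓝 (∑ k ∈ Finset.range (ord α), if k = k₀ then A else 0)) := by
      refine tendsto_finsetSum _ fun k hk => ?_
      rcases lt_trichotomy k k₀ with h | h | h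
      · simp [hmin k h, h.ne]
      · subst h
        simp [hA, div_eq_mul_inv]
      · have h' : (0 : ℝ) < (k : ℝ) - k₀ := by
          rw [sub_pos]; exact_mod_cast h
        simpa [h.ne'] using ((hpow _ h').div_const
          (Real.Gamma ((k : ℝ) + 1 - α))).const_mul (iteratedDeriv k g 0)
    rw [Finset.sum_ite_eq' , if_pos (Finset.mem_range.2 hlt)] at hs
    simpa using hs.add hz
  -- Factoring out the most singular power leaves a bracket with limit `A ≠ 0`, whose sign decides
  -- between `atTop` and `atBot`.
  have heq : (fun t : ℝ => t ^ ((k₀ : ℝ) - α) * (∑ k ∈ Finset.range (ord α),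
      iteratedDeriv k g 0 * (t ^ ((k : ℝ) - k₀) / Real.Gamma ((k : ℝ) + 1 - α)) +
      t ^ (α - k₀) * (1 / Real.Gamma ((ord α : ℝ) - α) *
        powConv ((ord α : ℝ) - α - 1) (iteratedDeriv (ord α) g) t))) =ᶠ[𝓝[>] 0]
      rlDeriv 0 α g := by
    filter_upwards [self_mem_nhdsWithin] with t ht
    have ht : 0 < t := ht
    rw [rlDeriv_eq hαN hg hB ht, mul_add, Finset.mul_sum, ← mul_assoc, ← Real.rpow_add ht]
    congr 1
    · refine Finset.sum_congr rfl fun k _ => ?_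
      rw [show (k : ℝ) - α = ((k₀ : ℝ) - α) + (k - k₀) by ring, Real.rpow_add ht]
      ring
    · simp
  have hinf : Tendsto (fun t : ℝ => t ^ ((k₀ : ℝ) - α)) (𝓝[>] 0) atTop :=
    tendsto_rpow_neg_nhdsGT_zero (by linarith)
  rcases lt_or_gt_of_ne hA0 with h | h
  · exact Or.inr ((hinf.atTop_mul_neg h hlim).congr' heq)
  · exact Or.inl ((hinf.atTop_mul_pos h hlim).congr' heq)

/-! ### Completeness of the translated powers -/

theorem hasDerivAt_integral_add_rpow {q T : ℝ} (hq : q ≤ 1) (hT : 0 ≤ T) {w : ℝ → ℝ}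
    (hw : Continuous w) {t : ℝ} (ht : 0 < t) :
    HasDerivAt (fun s => ∫ u in (0 : ℝ)..T, (s + u) ^ q * w u)
      (∫ u in (0 : ℝ)..T, q * (t + u) ^ (q - 1) * w u) t := by
  have hcont : ∀ s, 0 < s → ∀ r : ℝ, ContinuousOn (fun u : ℝ => (s + u) ^ r) (uIcc 0 T) := by
    intro s hs r
    refine ContinuousOn.rpow_const (by fun_prop) fun u hu => Or.inl ?_
    rw [uIcc_of_le hT] at hu
    linarith [hu.1]
  refine (intervalIntegral.hasDerivAt_integral_of_dominated_loc_of_deriv_le (μ := volume)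
    (F := fun s u => (s + u) ^ q * w u) (F' := fun s u => q * (s + u) ^ (q - 1) * w u)
    (bound := fun u => |q| * (t / 2) ^ (q - 1) * |w u|) (s := Ioi (t / 2))
    (Ioi_mem_nhds (by linarith)) ?_ ?_ ?_ ?_ ?_ ?_).2
  · filter_upwards [Ioi_mem_nhds ht] with s hs
    exact (((hcont s hs q).mul hw.continuousOn).mono
      uIoc_subset_uIcc).aestronglyMeasurable measurableSet_uIoc
  · exact ((hcont t ht q).mul hw.continuousOn).intervalIntegrable
  · exact (((continuousOn_const.mul (hcont t ht (q - 1))).mul hw.continuousOn).mono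
      uIoc_subset_uIcc).aestronglyMeasurable measurableSet_uIoc
  · refine Eventually.of_forall fun u hu s hs => ?_
    rw [uIoc_of_le hT] at hu
    have hs : t / 2 < s := hs
    have hle : t / 2 ≤ s + u := by linarith [hu.1]
    rw [Real.norm_eq_abs, abs_mul, abs_mul, abs_of_nonneg (Real.rpow_nonneg (by linarith) _)]
    have := Real.rpow_le_rpow_of_nonpos (by positivity) hle (by linarith : q - 1 ≤ 0)
    gcongr
  · exact (continuous_const.mul hw.abs).intervalIntegrable _ _
  · refine Eventually.of_forall fun u hu s hs => ?_
    rw [uIoc_of_le hT] at hu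
    have hs : t / 2 < s := hs
    have := ((hasDerivAt_id s).add_const u).rpow_const (p := q)
      (Or.inl (by simp only [id]; linarith [hu.1]))
    simpa using this.mul_const (w u)

/-- Differentiating the identity in `t` lowers the exponent by one; the factor `p - k` that appears
is non-zero because `p < 0`. -/
theorem integral_add_rpow_sub_natCast_eq_zero {p T : ℝ} (hp : p < 0) (hT : 0 ≤ T) {w : ℝ → ℝ}
    (hw : Continuous w) (h : ∀ t, 0 < t → ∫ u in (0 : ℝ)..T, (t + u) ^ p * w u = 0) (k : ℕ) :
    ∀ t, 0 < t → ∫ u in (0 : ℝ)..T, (t + u) ^ (p - k) * w u = 0 := by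
  induction k with
  | zero => simpa using h
  | succ k ih =>
    intro t ht
    have hk : (0 : ℝ) ≤ k := k.cast_nonneg
    have hd := hasDerivAt_integral_add_rpow (q := p - k) (by linarith) hT hw ht
    have hz : (fun s => ∫ u in (0 : ℝ)..T, (s + u) ^ (p - k) * w u) =ᶠ[𝓝 t] fun _ => 0 := by
      filter_upwards [Ioi_mem_nhds ht] with s hs using ih s hs
    have h0 := (hd.congr_of_eventuallyEq hz.symm).unique (hasDerivAt_const t 0)
    simp only [mul_assoc] at h0
    rw [intervalIntegral.integral_const_mul] at h0
    have hne : p - k ≠ 0 := by linarith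
    push_cast
    rw [← sub_sub]
    exact (mul_eq_zero.1 h0).resolve_left hne

/-- The powers `(t + u) ^ p`, `t > 0`, with a fixed `p < 0` span a dense subspace of the
continuous functions on `[0, T]`. -/
theorem eq_zero_of_forall_integral_add_rpow_eq_zero {p T : ℝ} (hp : p < 0) (hT : 0 < T)
    {w : ℝ → ℝ} (hw : Continuous w)
    (h : ∀ t, 0 < t → ∫ u in (0 : ℝ)..T, (t + u) ^ p * w u = 0) :
    ∀ u ∈ Icc 0 T, w u = 0 := by
  have hcont : ∀ r : ℝ, ContinuousOn (fun u : ℝ => (1 + u) ^ r) (Icc 0 T) := fun r =>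
    ContinuousOn.rpow_const (by fun_prop) fun u hu => Or.inl (by linarith [hu.1])
  have hinv : ContinuousOn (fun u : ℝ => (1 + u)⁻¹) (Icc 0 T) :=
    ContinuousOn.inv₀ (by fun_prop) fun u hu => by linarith [hu.1]
  have hii : ∀ {f : ℝ → ℝ}, ContinuousOn f (Icc 0 T) → IntervalIntegrable f volume 0 T :=
    fun hf => ContinuousOn.intervalIntegrable (by rwa [uIcc_of_le hT.le])
  have hpoly : ∀ P : Polynomial ℝ,
      ∫ u in (0 : ℝ)..T, (1 + u) ^ p * w u * P.eval ((1 + u)⁻¹) = 0 := by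
    intro P
    simp only [Polynomial.eval_eq_sum_range, Finset.mul_sum]
    rw [intervalIntegral.integral_finsetSum]
    swap
    · exact fun i _ => hii
        (((hcont p).mul hw.continuousOn).mul (continuousOn_const.mul (hinv.pow i)))
    refine Finset.sum_eq_zero fun i _ => ?_
    have hz := congrArg (P.coeff i * ·)
      (integral_add_rpow_sub_natCast_eq_zero hp hT.le hw h i 1 one_pos)
    simp only [mul_zero, ← intervalIntegral.integral_const_mul] at hz
    refine Eq.trans (intervalIntegral.integral_congr fun u hu => ?_) hz
    rw [uIcc_of_le hT.le] at hu
    have hu1 : 0 < 1 + u := by linarith [hu.1]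
    rw [Real.rpow_sub hu1, Real.rpow_natCast, inv_pow]
    field_simp
  set C := ∫ u in (0 : ℝ)..T, |(1 + u) ^ p * w u| with hC
  have hC0 : 0 ≤ C := intervalIntegral.integral_nonneg hT.le fun u _ => abs_nonneg _
  -- Orthogonality is tested on `w` itself, read as a function of `v = 1/(1+u)` and approximated
  -- uniformly by polynomials in `v`. The tolerance `δ / (C + 1)` makes the error at most `δ`, also
  -- when `C = 0`.
  have hI : ∫ u in (0 : ℝ)..T, (1 + u) ^ p * w u * w u ≤ 0 := by
    refine le_of_forall_pos_le_add fun δ hδ => ?_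
    have hf : ContinuousOn (fun v : ℝ => w (v⁻¹ - 1)) (Icc ((1 + T)⁻¹) 1) := by
      refine hw.comp_continuousOn ((ContinuousOn.inv₀ (by fun_prop) fun v hv => ?_).sub
        continuousOn_const)
      exact (lt_of_lt_of_le (by positivity) hv.1).ne'
    obtain ⟨P, hP⟩ := exists_polynomial_near_of_continuousOn _ _ _ hf (δ / (C + 1))
      (by positivity)
    have hcP : ContinuousOn (fun u : ℝ => P.eval ((1 + u)⁻¹)) (Icc 0 T) :=
      P.continuous.comp_continuousOn hinv
    have hbase := (hcont p).mul hw.continuousOn (s := Icc 0 T)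
    calc ∫ u in (0 : ℝ)..T, (1 + u) ^ p * w u * w u
        = ∫ u in (0 : ℝ)..T, (1 + u) ^ p * w u * (w u - P.eval ((1 + u)⁻¹)) := by
          simp only [mul_sub]
          have := intervalIntegral.integral_sub (hii (hbase.mul hw.continuousOn))
            (hii (hbase.mul hcP))
          exact ((this.trans (congrArg _ (hpoly P))).trans (sub_zero _)).symm
      _ ≤ ∫ u in (0 : ℝ)..T, δ / (C + 1) * |(1 + u) ^ p * w u| := by
          refine intervalIntegral.integral_mono_on hT.le
            (hii (hbase.mul (hw.continuousOn.sub hcP)))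
            (hii (continuousOn_const.mul hbase.abs)) fun u hu => ?_
          refine (le_abs_self _).trans ?_
          rw [abs_mul, mul_comm]
          have hu1 : 0 < 1 + u := by linarith [hu.1]
          have := hP ((1 + u)⁻¹) ⟨by gcongr; exact hu.2,
            inv_le_one_of_one_le₀ (by linarith [hu.1])⟩
          rw [inv_inv, add_sub_cancel_left, abs_sub_comm] at this
          gcongr
      _ = δ / (C + 1) * C := by rw [intervalIntegral.integral_const_mul]
      _ ≤ 0 + δ := by
          rw [zero_add, div_mul_eq_mul_div, div_le_iff₀ (by positivity)]
          nlinarith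
  intro u hu
  by_contra hne
  have hnn : ∀ v ∈ Icc 0 T, 0 < (1 + v) ^ p := fun v hv =>
    Real.rpow_pos_of_pos (by linarith [hv.1]) p
  refine absurd hI (not_le.2 (intervalIntegral.integral_pos hT
    (((hcont p).mul hw.continuousOn).mul hw.continuousOn) (fun v hv => ?_) ⟨u, hu, ?_⟩))
  · rw [mul_assoc]
    exact mul_nonneg (hnn v (Ioc_subset_Icc_self hv)).le (mul_self_nonneg _)
  · rw [mul_assoc]
    exact mul_pos (hnn u hu) (mul_self_pos.2 hne)

/-! ### Rigidity: a periodic derivative forces the function to vanish -/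

/-- Periodicity gives both convolutions the same integrand, so only the integral over `[t, t + T]`
survives. -/
theorem powConv_add_period_sub {γ : ℝ} (hγ : -1 < γ) {z : ℝ → ℝ} (hz : Continuous z) {T : ℝ}
    (hper : Function.Periodic z T) (t : ℝ) :
    powConv γ z (t + T) - powConv γ z t = ∫ u in (0 : ℝ)..T, (t + u) ^ γ * z (-u) := by
  have h1 : powConv γ z (t + T) = ∫ u in (0 : ℝ)..(t + T), u ^ γ * z (t - u) := by
    refine intervalIntegral.integral_congr fun u _ => ?_
    rw [show t + T - u = t - u + T by ring, hper]
  have hi := intervalIntegrable_rpow_mul hγ (g := fun u => z (t - u)) (by fun_prop)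
  rw [h1, powConv, intervalIntegral.integral_interval_sub_left (hi 0 (t + T)) (hi 0 t)]
  have h2 := intervalIntegral.integral_comp_add_left (a := 0) (b := T)
    (fun u : ℝ => u ^ γ * z (t - u)) t
  rw [add_zero] at h2
  rw [← h2]
  simp

theorem eq_zero_of_iteratedDeriv_eq_zero {n : ℕ} {g : ℝ → ℝ} (hg : ContDiff ℝ n g)
    (hn : ∀ s, iteratedDeriv n g s = 0) (h0 : ∀ k < n, iteratedDeriv k g 0 = 0) (s : ℝ) :
    g s = 0 := by
  induction n generalizing g s with
  | zero => simpa using hn s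
  | succ n ih =>
    have hg1 : ContDiff ℝ n (deriv g) := by
      have := hg
      push_cast at this
      exact (contDiff_succ_iff_deriv.1 this).2.2
    have hd : ∀ s, deriv g s = 0 := ih hg1 (by simpa [iteratedDeriv_succ'] using hn)
      fun k hk => by simpa [iteratedDeriv_succ'] using h0 (k + 1) (by omega)
    rw [is_const_of_deriv_eq_zero (hg.differentiable (by simp)) hd s 0]
    simpa using h0 0 (by omega)

theorem _root_.Function.Periodic.iteratedDeriv {g : ℝ → ℝ} {T : ℝ} (h : Function.Periodic g T)
    (k : ℕ) : Function.Periodic (iteratedDeriv k g) T := fun t => by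
  have := congrFun (iteratedDeriv_comp_add_const k g T) t
  rw [← this, funext h]

theorem exists_bound_iteratedDeriv {g : ℝ → ℝ} {T : ℝ} (hT : 0 < T)
    (h : Function.Periodic g T) {n : ℕ} (hg : ContDiff ℝ n g) (k : ℕ) (hk : k ≤ n) :
    ∃ B, ∀ s, |iteratedDeriv k g s| ≤ B := by
  obtain ⟨B, hB⟩ := ((h.iteratedDeriv k).isBounded_of_continuous hT.ne'
    (hg.continuous_iteratedDeriv k (by exact_mod_cast hk))).exists_norm_le
  exact ⟨B, fun s => hB _ (mem_range_self s)⟩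

/-- A periodic function with periodic Riemann–Liouville derivative vanishes. -/
theorem eq_zero_of_periodicOnPos_rlDeriv {α : ℝ} (hα : 0 < α) (hαN : ∀ m : ℕ, α ≠ (m : ℝ))
    {T : ℝ} (hT : 0 < T) {g : ℝ → ℝ} (hg : ContDiff ℝ (ord α) g) (hper : Function.Periodic g T)
    (hrl : PeriodicOnPos T (rlDeriv 0 α g)) (s : ℝ) : g s = 0 := by
  have hB := exists_bound_iteratedDeriv hT hper hg
  have hγ : -1 < (ord α : ℝ) - α - 1 := by linarith [lt_ord α]
  -- Periodicity and continuity at `T` give a finite limit at `0⁺`, which excludes blow-up.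
  have h0 : ∀ k < ord α, iteratedDeriv k g 0 = 0 := by
    by_contra! hne
    have hcont : ContinuousAt (fun t => rlDeriv 0 α g (t + T)) 0 := by
      have hc : ContinuousAt (iteratedDeriv (ord α) (kernelIntegral 0 α g)) T := by
        have := (contDiffOn_kernelIntegral hg hB).continuousOn_iteratedDerivWithin le_rfl
          (uniqueDiffOn_Ioi 0)
        exact (this.congr (iteratedDerivWithin_of_isOpen isOpen_Ioi).symm).continuousAt
          (Ioi_mem_nhds hT)
      have : ContinuousAt (rlDeriv 0 α g) (0 + T) := by
        rw [zero_add]; exact continuousAt_const.mul hc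
      exact this.comp (f := fun t : ℝ => t + T) (by fun_prop)
    have hlim : Tendsto (rlDeriv 0 α g) (𝓝[>] 0) (𝓝 (rlDeriv 0 α g (0 + T))) := by
      refine (hcont.tendsto.mono_left nhdsWithin_le_nhds).congr' ?_
      filter_upwards [self_mem_nhdsWithin] with t ht using hrl t ht
    rcases tendsto_rlDeriv_atTop_or_atBot hα hαN hg hB hne with h | h
    · exact not_tendsto_nhds_of_tendsto_atTop h _ hlim
    · exact not_tendsto_nhds_of_tendsto_atBot h _ hlim
  set z := iteratedDeriv (ord α) g with hz
  have hzc : Continuous z := hg.continuous_iteratedDeriv _ le_rfl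
  have hzp : Function.Periodic z T := hper.iteratedDeriv _
  have hrl' : ∀ t, 0 < t → rlDeriv 0 α g t =
      1 / Real.Gamma ((ord α : ℝ) - α) * powConv ((ord α : ℝ) - α - 1) z t := fun t ht => by
    rw [rlDeriv_eq hαN hg hB ht, Finset.sum_eq_zero, zero_add]
    intro k hk
    rw [h0 k (Finset.mem_range.1 hk), zero_mul]
  have hΓ : 1 / Real.Gamma ((ord α : ℝ) - α) ≠ 0 :=
    one_div_ne_zero (Real.Gamma_pos_of_pos (by linarith [lt_ord α])).ne'
  have hw := eq_zero_of_forall_integral_add_rpow_eq_zero (p := (ord α : ℝ) - α - 1)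
    (w := fun u => z (-u)) (by linarith [ord_sub_one_lt hα hαN]) hT (by fun_prop)
    fun t ht => by
      rw [← powConv_add_period_sub hγ hzc hzp t, sub_eq_zero]
      have := hrl t ht
      rw [hrl' t ht, hrl' (t + T) (by linarith)] at this
      exact mul_left_cancel₀ hΓ this
  refine eq_zero_of_iteratedDeriv_eq_zero hg (fun s => ?_) h0 s
  -- The window `[-T, 0)` is chosen because `hw` controls `z` at the points `-u`, `u ∈ [0, T]`.
  obtain ⟨v, hv, hvs⟩ := hzp.exists_mem_Ico hT s (-T)
  change z s = 0
  rw [hvs]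
  have := hw (-v) ⟨by linarith [hv.2], by linarith [hv.1]⟩
  simpa using this

/-! ### Asymptotics of the binomial coefficients -/

theorem neg_one_pow_mul_choose (α : ℝ) (r : ℕ) :
    (-1 : ℝ) ^ r * Ring.choose α r = Ring.multichoose (-α) r := by
  have h := Ring.choose_neg (-α) r
  rw [neg_neg] at h
  rw [h, Ring.multichoose_eq]
  rcases Nat.even_or_odd r with hr | hr
  · simp [Int.negOnePow_even r (by exact_mod_cast hr), hr.neg_one_pow]
  · simp [Int.negOnePow_odd r (by exact_mod_cast hr), hr.neg_one_pow]

theorem multichoose_eq_prod_div (s : ℝ) (m : ℕ) :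
    Ring.multichoose s m = (∏ j ∈ Finset.range m, (s + j)) / m.factorial := by
  have hprod : (ascPochhammer ℝ m).eval s = ∏ j ∈ Finset.range m, (s + j) := by
    induction m with
    | zero => simp
    | succ m ih => rw [ascPochhammer_succ_eval, ih, Finset.prod_range_succ]
  have h := Ring.factorial_nsmul_multichoose_eq_ascPochhammer s m
  rw [Polynomial.ascPochhammer_smeval_eq_eval, hprod] at h
  rw [← h, nsmul_eq_mul]
  field_simp

/-- This is Euler's limit for `Γ`: the `m`-th term equals `m / (m + s)` divided by `Real.GammaSeq s
m`. -/
theorem tendsto_multichoose_mul_rpow {s : ℝ} (hs : ∀ m : ℕ, s ≠ -m) :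
    Tendsto (fun m : ℕ => Ring.multichoose s m * (m : ℝ) ^ (1 - s)) atTop
      (𝓝 (1 / Real.Gamma s)) := by
  have h1 := (tendsto_natCast_div_add_atTop s).div (Real.GammaSeq_tendsto_Gamma s)
    (Real.Gamma_ne_zero hs)
  refine h1.congr' ?_
  filter_upwards [eventually_gt_atTop 0] with m hm
  have hm' : (0 : ℝ) < m := by exact_mod_cast hm
  have hprod : ∏ j ∈ Finset.range m, (s + j) ≠ 0 := Finset.prod_ne_zero_iff.2 fun j _ h =>
    hs j (by linarith)
  have hsm : s + m ≠ 0 := fun h => hs m (by linarith)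
  have hsm' : (m : ℝ) + s ≠ 0 := by rwa [add_comm]
  have hf : (m.factorial : ℝ) ≠ 0 := by positivity
  have hpow : (m : ℝ) ^ s ≠ 0 := (Real.rpow_pos_of_pos hm' s).ne'
  simp only [Pi.div_apply]
  rw [multichoose_eq_prod_div, Real.GammaSeq, Finset.prod_range_succ, Real.rpow_sub hm',
    Real.rpow_one]
  field_simp
  ring

/-- A convergent sequence is bounded. The base `m + 1` covers `m = 0` and later compares with `u / h
< ⌊u / h⌋₊ + 1`; its cost is `2 ^ (1 - s)`, from `m + 1 ≤ 2 * m`. -/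
theorem exists_multichoose_le {s : ℝ} (hs0 : 0 < s) (hs1 : s ≤ 1) :
    ∃ C : ℝ, 0 ≤ C ∧ ∀ m : ℕ, |Ring.multichoose s m| ≤ C * ((m : ℝ) + 1) ^ (s - 1) := by
  have hlim := tendsto_multichoose_mul_rpow (s := s) fun m h => by
    have : (0 : ℝ) ≤ m := m.cast_nonneg
    linarith
  obtain ⟨C, hC⟩ := (Metric.isBounded_range_of_tendsto _ hlim).exists_norm_le
  have hC' : ∀ m : ℕ, |Ring.multichoose s m| * (m : ℝ) ^ (1 - s) ≤ C := fun m => by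
    have := hC _ (mem_range_self m)
    rwa [Real.norm_eq_abs, abs_mul, abs_of_nonneg (Real.rpow_nonneg m.cast_nonneg _)] at this
  refine ⟨max 1 (C * 2 ^ (1 - s)), le_max_of_le_left zero_le_one, fun m => ?_⟩
  rcases Nat.eq_zero_or_pos m with rfl | hm
  · simp
  have hm' : (1 : ℝ) ≤ m := by exact_mod_cast hm
  have hm0 : (0 : ℝ) < (m : ℝ) + 1 := by positivity
  rw [show s - 1 = -(1 - s) by ring, Real.rpow_neg hm0.le, ← div_eq_mul_inv,
    le_div_iff₀ (Real.rpow_pos_of_pos hm0 _)]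
  calc |Ring.multichoose s m| * ((m : ℝ) + 1) ^ (1 - s)
      ≤ |Ring.multichoose s m| * (m * 2 : ℝ) ^ (1 - s) := by
        gcongr
        linarith
    _ = |Ring.multichoose s m| * (m : ℝ) ^ (1 - s) * 2 ^ (1 - s) := by
        rw [Real.mul_rpow (by positivity) (by positivity), mul_assoc]
    _ ≤ C * 2 ^ (1 - s) := by gcongr; exact hC' m
    _ ≤ _ := le_max_right _ _

theorem tendsto_floor_div_atTop {u : ℝ} (hu : 0 < u) :
    Tendsto (fun h : ℝ => ⌊u / h⌋₊) (𝓝[>] 0) atTop := by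
  refine tendsto_nat_floor_atTop.comp ?_
  exact tendsto_inv_nhdsGT_zero.const_mul_atTop hu

theorem floor_div_mul_le {u h : ℝ} (hu : 0 ≤ u) (hh : 0 < h) : ⌊u / h⌋₊ * h ≤ u := by
  have := Nat.floor_le (div_nonneg hu hh.le)
  rwa [le_div_iff₀ hh] at this

theorem lt_floor_div_add_one_mul (u : ℝ) {h : ℝ} (hh : 0 < h) :
    u < ((⌊u / h⌋₊ : ℝ) + 1) * h := by
  have := Nat.lt_floor_add_one (u / h)
  rwa [div_lt_iff₀ hh] at this

theorem tendsto_id_nhdsGT_zero : Tendsto (fun h : ℝ => h) (𝓝[>] 0) (𝓝 0) :=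
  tendsto_id.mono_left nhdsWithin_le_nhds

theorem tendsto_floor_div_mul {u : ℝ} (hu : 0 ≤ u) :
    Tendsto (fun h : ℝ => ⌊u / h⌋₊ * h) (𝓝[>] 0) (𝓝 u) := by
  have hlow : Tendsto (fun h : ℝ => u - h) (𝓝[>] 0) (𝓝 u) := by
    simpa using tendsto_id_nhdsGT_zero.const_sub u
  refine tendsto_of_tendsto_of_tendsto_of_le_of_le' hlow tendsto_const_nhds ?_ ?_
  · filter_upwards [self_mem_nhdsWithin] with h hh
    have := lt_floor_div_add_one_mul u (show 0 < h from hh)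
    linarith
  · filter_upwards [self_mem_nhdsWithin] with h hh using floor_div_mul_le hu hh

theorem tendsto_rpow_mul_multichoose_floor {s u : ℝ} (hs : ∀ m : ℕ, s ≠ -m) (hu : 0 < u) :
    Tendsto (fun h : ℝ => h ^ (s - 1) * Ring.multichoose s ⌊u / h⌋₊) (𝓝[>] 0)
      (𝓝 (u ^ (s - 1) / Real.Gamma s)) := by
  have h1 := (tendsto_multichoose_mul_rpow hs).comp (tendsto_floor_div_atTop hu)
  have h2 : Tendsto (fun h : ℝ => (⌊u / h⌋₊ * h) ^ (s - 1)) (𝓝[>] 0) (𝓝 (u ^ (s - 1))) :=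
    (Real.continuousAt_rpow_const u (s - 1) (Or.inl hu.ne')).tendsto.comp
      (tendsto_floor_div_mul hu.le)
  have h3 := h2.mul h1
  rw [mul_one_div] at h3
  refine h3.congr' ?_
  filter_upwards [self_mem_nhdsWithin,
    (tendsto_floor_div_atTop hu).eventually (eventually_gt_atTop 0)] with h hh hN
  have hh : 0 < h := hh
  have hN' : (0 : ℝ) < ⌊u / h⌋₊ := by exact_mod_cast hN
  simp only [Function.comp_apply]
  rw [Real.mul_rpow hN'.le hh.le, show 1 - s = -(s - 1) by ring, Real.rpow_neg hN'.le]
  have := (Real.rpow_pos_of_pos hN' (s - 1)).ne'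
  field_simp

/-! ### Summation by parts and backward differences -/

/-- The backward difference of step `h`. -/
def bwdDiff (h : ℝ) (f : ℝ → ℝ) (t : ℝ) : ℝ := f t - f (t - h)

/-- Abel summation: by Pascal's rule the coefficients for `s + 1` are the partial sums of those for
`s`. -/
theorem sum_multichoose_mul (s : ℝ) (f : ℕ → ℝ) (N : ℕ) :
    ∑ r ∈ Finset.range (N + 1), Ring.multichoose s r * f r =
      Ring.multichoose (s + 1) N * f (N + 1) +
        ∑ r ∈ Finset.range (N + 1), Ring.multichoose (s + 1) r * (f r - f (r + 1)) := by
  induction N with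
  | zero => simp
  | succ N ih =>
    rw [Finset.sum_range_succ, ih, Finset.sum_range_succ _ (N + 1),
      Ring.multichoose_succ_succ s N]
    ring

/-- Iterated summation by parts in the Grünwald–Letnikov sum. -/
theorem sum_multichoose_mul_bwdDiff (s : ℝ) (f : ℝ → ℝ) (t h : ℝ) (N n : ℕ) :
    ∑ r ∈ Finset.range (N + 1), Ring.multichoose s r * f (t - r * h) =
      ∑ k ∈ Finset.range n,
        Ring.multichoose (s + k + 1) N * (bwdDiff h)^[k] f (t - (N + 1) * h) +
      ∑ r ∈ Finset.range (N + 1),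
        Ring.multichoose (s + n) r * (bwdDiff h)^[n] f (t - r * h) := by
  induction n with
  | zero => simp
  | succ n ih =>
    rw [ih, Finset.sum_range_succ _ n,
      sum_multichoose_mul (s + n) (fun r => (bwdDiff h)^[n] f (t - r * h)), ← add_assoc]
    simp only [Function.iterate_succ_apply']
    push_cast
    rw [← add_assoc s]
    congr 1
    refine Finset.sum_congr rfl fun r _ => ?_
    rw [bwdDiff, show t - ((r : ℝ) + 1) * h = t - r * h - h by ring]

theorem exists_iterate_bwdDiff_eq {h : ℝ} (hh : 0 < h) (k : ℕ) {f : ℝ → ℝ}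
    (hf : ContDiff ℝ k f) (t : ℝ) :
    ∃ ξ ∈ Icc (t - k * h) t, (bwdDiff h)^[k] f t = h ^ k * iteratedDeriv k f ξ := by
  induction k generalizing f with
  | zero => exact ⟨t, by simp, by simp⟩
  | succ k ih =>
    have hfk : ContDiff ℝ k f := hf.of_le (by exact_mod_cast k.le_succ)
    have hfs : ContDiff ℝ k fun z => f (z - h) := hfk.comp (by fun_prop)
    -- The induction is applied to the first difference, so that a single mean value step for the
    -- `k`-th derivative finishes.
    obtain ⟨ξ, hξ, hξeq⟩ := ih (f := bwdDiff h f) (hfk.sub hfs)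
    have hd : iteratedDeriv k (bwdDiff h f) ξ =
        iteratedDeriv k f ξ - iteratedDeriv k f (ξ - h) := by
      unfold bwdDiff
      rw [iteratedDeriv_fun_sub hfk.contDiffAt hfs.contDiffAt,
        congrFun (iteratedDeriv_comp_sub_const k f h) ξ]
    have hdiff : Differentiable ℝ (iteratedDeriv k f) :=
      hf.differentiable_iteratedDeriv k (by exact_mod_cast k.lt_succ_self)
    obtain ⟨η, hη, hηeq⟩ := exists_deriv_eq_slope (iteratedDeriv k f)
      (show ξ - h < ξ by linarith) hdiff.continuous.continuousOn hdiff.differentiableOn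
    refine ⟨η, ⟨?_, ?_⟩, ?_⟩
    · push_cast
      linarith [hξ.1, hη.1]
    · linarith [hξ.2, hη.2]
    · rw [Function.iterate_succ_apply, hξeq, hd, iteratedDeriv_succ, hηeq]
      rw [sub_sub_cancel, pow_succ]
      field_simp

theorem tendsto_iterate_bwdDiff_div {k : ℕ} {f : ℝ → ℝ} (hf : ContDiff ℝ k f) {τ : ℝ → ℝ}
    {a : ℝ} (hτ : Tendsto τ (𝓝[>] 0) (𝓝 a)) :
    Tendsto (fun h => (bwdDiff h)^[k] f (τ h) / h ^ k) (𝓝[>] 0) (𝓝 (iteratedDeriv k f a)) := by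
  have hex : ∀ h : ℝ, ∃ ξ, 0 < h →
      ξ ∈ Icc (τ h - k * h) (τ h) ∧ (bwdDiff h)^[k] f (τ h) = h ^ k * iteratedDeriv k f ξ := by
    intro h
    by_cases hh : 0 < h
    · obtain ⟨ξ, h1, h2⟩ := exists_iterate_bwdDiff_eq hh k hf (τ h)
      exact ⟨ξ, fun _ => ⟨h1, h2⟩⟩
    · exact ⟨0, fun h' => absurd h' hh⟩
  choose ξ hξ using hex
  have hlow : Tendsto (fun h => τ h - k * h) (𝓝[>] 0) (𝓝 a) := by
    simpa using hτ.sub (tendsto_id_nhdsGT_zero.const_mul (k : ℝ))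
  have hlim : Tendsto ξ (𝓝[>] 0) (𝓝 a) := by
    refine tendsto_of_tendsto_of_tendsto_of_le_of_le' hlow hτ ?_ ?_
    · filter_upwards [self_mem_nhdsWithin] with h hh using (hξ h hh).1.1
    · filter_upwards [self_mem_nhdsWithin] with h hh using (hξ h hh).1.2
  have hc : Continuous (iteratedDeriv k f) := hf.continuous_iteratedDeriv k le_rfl
  refine ((hc.tendsto a).comp hlim).congr' ?_
  filter_upwards [self_mem_nhdsWithin] with h hh
  have hh0 : h ≠ 0 := ne_of_gt hh
  rw [(hξ h hh).2, Function.comp_apply]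
  field_simp

theorem abs_iterate_bwdDiff_div_le {k : ℕ} {f : ℝ → ℝ} (hf : ContDiff ℝ k f) {B : ℝ}
    (hB : ∀ s, |iteratedDeriv k f s| ≤ B) {h : ℝ} (hh : 0 < h) (t : ℝ) :
    |(bwdDiff h)^[k] f t / h ^ k| ≤ B := by
  obtain ⟨ξ, -, h2⟩ := exists_iterate_bwdDiff_eq hh k hf t
  rw [h2, mul_div_cancel_left₀ _ (by positivity)]
  exact hB ξ

/-! ### Convergence of the Grünwald–Letnikov quotients -/

theorem integral_comp_floor_div {h : ℝ} (hh : 0 < h) (F : ℕ → ℝ) (M : ℕ) :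
    ∫ u in (0 : ℝ)..(M * h), F ⌊u / h⌋₊ = h * ∑ r ∈ Finset.range M, F r := by
  have hcell : ∀ r : ℕ, ∀ᵐ u : ℝ ∂volume, u ∈ uIoc ((r : ℝ) * h) ((r + 1 : ℕ) * h) →
      F ⌊u / h⌋₊ = F r := by
    intro r
    have hne : ∀ᵐ u : ℝ ∂volume, u ≠ (r + 1 : ℕ) * h := by simp [ae_iff]
    filter_upwards [hne] with u hu hmem
    rw [uIoc_of_le (by push_cast; nlinarith)] at hmem
    have h1 : u < (r + 1 : ℕ) * h := lt_of_le_of_ne hmem.2 hu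
    have h2 : ⌊u / h⌋₊ = r := by
      rw [Nat.floor_eq_iff (div_nonneg (le_trans (by positivity) hmem.1.le) hh.le)]
      refine ⟨(le_div_iff₀ hh).2 hmem.1.le, (div_lt_iff₀ hh).2 ?_⟩
      exact_mod_cast h1
    rw [h2]
  have hint : ∀ r : ℕ, IntervalIntegrable (fun u => F ⌊u / h⌋₊) volume
      ((r : ℝ) * h) ((r + 1 : ℕ) * h) := fun r =>
    (intervalIntegrable_const (c := F r)).congr_ae
      ((ae_restrict_iff' measurableSet_uIoc).2 ((hcell r).mono fun u hu hm => (hu hm).symm))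
  have hsum := intervalIntegral.sum_integral_adjacent_intervals (μ := volume)
    (f := fun u => F ⌊u / h⌋₊) (a := fun r : ℕ => (r : ℝ) * h) (n := M) fun r _ => hint r
  simp only [Nat.cast_zero, zero_mul] at hsum
  rw [← hsum, Finset.mul_sum]
  refine Finset.sum_congr rfl fun r _ => ?_
  rw [intervalIntegral.integral_congr_ae (hcell r), intervalIntegral.integral_const]
  push_cast
  rw [smul_eq_mul]
  ring

/-- The weakly singular Riemann sums converge to the convolution with `u ^ (β - 1) / Γ β`. -/
theorem tendsto_sum_multichoose_mul_bwdDiff {β : ℝ} (hβ0 : 0 < β) (hβ1 : β ≤ 1) {n : ℕ}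
    {f : ℝ → ℝ} (hf : ContDiff ℝ n f) {B : ℝ} (hB : ∀ s, |iteratedDeriv n f s| ≤ B)
    {t : ℝ} (ht : 0 < t) :
    Tendsto (fun h : ℝ => h ^ β * ∑ r ∈ Finset.range (⌊t / h⌋₊ + 1),
        Ring.multichoose β r * ((bwdDiff h)^[n] f (t - r * h) / h ^ n)) (𝓝[>] 0)
      (𝓝 (1 / Real.Gamma β * powConv (β - 1) (iteratedDeriv n f) t)) := by
  have hpole : ∀ m : ℕ, β ≠ -m := fun m h => by
    have : (0 : ℝ) ≤ m := m.cast_nonneg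
    linarith
  obtain ⟨C, hC0, hC⟩ := exists_multichoose_le hβ0 hβ1
  set G : ℝ → ℕ → ℝ := fun h r =>
    h ^ (β - 1) * Ring.multichoose β r * ((bwdDiff h)^[n] f (t - r * h) / h ^ n) with hG
  -- The sum is the integral of a step function cut off at `(⌊t/h⌋₊ + 1) * h`. For `h < 1` this is
  -- at most `t + 1`, so `[0, t + 1]` serves as a fixed domain.
  set F : ℝ → ℝ → ℝ := fun h =>
    (Iio (((⌊t / h⌋₊ + 1 : ℕ) : ℝ) * h)).indicator fun u => G h ⌊u / h⌋₊ with hF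
  set φ : ℝ → ℝ := (Iio t).indicator fun u =>
    u ^ (β - 1) / Real.Gamma β * iteratedDeriv n f (t - u) with hφ
  have hlim : Tendsto (fun h => ∫ u in (0 : ℝ)..(t + 1), F h u) (𝓝[>] 0)
      (𝓝 (∫ u in (0 : ℝ)..(t + 1), φ u)) := by
    refine intervalIntegral.tendsto_integral_filter_of_dominated_convergence
      (fun u => C * u ^ (β - 1) * B) ?_ ?_ ?_ ?_
    · refine Eventually.of_forall fun h => ?_
      have hm : Measurable fun u : ℝ => G h ⌊u / h⌋₊ :=
        (measurable_from_nat (f := G h)).comp (Nat.measurable_floor.comp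
          (measurable_id.div_const h))
      exact (hm.indicator measurableSet_Iio).aestronglyMeasurable
    · filter_upwards [self_mem_nhdsWithin] with h hh
      have hh : 0 < h := hh
      refine Eventually.of_forall fun u hu => ?_
      rw [uIoc_of_le (by linarith)] at hu
      refine (norm_indicator_le_norm_self _ _).trans ?_
      rw [Real.norm_eq_abs, hG]
      simp only
      rw [abs_mul]
      have h1 := abs_iterate_bwdDiff_div_le hf hB hh (t - ⌊u / h⌋₊ * h)
      have h2 : |h ^ (β - 1) * Ring.multichoose β ⌊u / h⌋₊| ≤ C * u ^ (β - 1) := by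
        rw [abs_mul, abs_of_pos (Real.rpow_pos_of_pos hh _)]
        calc h ^ (β - 1) * |Ring.multichoose β ⌊u / h⌋₊|
            ≤ h ^ (β - 1) * (C * ((⌊u / h⌋₊ : ℝ) + 1) ^ (β - 1)) := by
              gcongr
              exact hC _
          -- Since `β - 1 ≤ 0`, replacing `⌊u/h⌋₊ + 1` by the smaller `u / h` increases the bound,
          -- and the powers of `h` cancel.
          _ ≤ h ^ (β - 1) * (C * (u / h) ^ (β - 1)) := by
              have := Real.rpow_le_rpow_of_nonpos (div_pos hu.1 hh)
                (Nat.lt_floor_add_one (u / h)).le (by linarith : β - 1 ≤ 0)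
              gcongr
          _ = C * u ^ (β - 1) := by
              rw [Real.div_rpow hu.1.le hh.le]
              have := (Real.rpow_pos_of_pos hh (β - 1)).ne'
              field_simp
      exact mul_le_mul h2 h1 (abs_nonneg _)
        (mul_nonneg hC0 (Real.rpow_nonneg hu.1.le _))
    · exact ((intervalIntegral.intervalIntegrable_rpow' (by linarith)).const_mul C).mul_const B
    · have hne : ∀ᵐ u : ℝ ∂volume, u ≠ t := by simp [ae_iff]
      filter_upwards [hne] with u hut hu
      rw [uIoc_of_le (by linarith)] at hu
      rcases lt_or_gt_of_ne hut with h | h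
      · rw [hφ, indicator_of_mem (show u ∈ Iio t from h)]
        have hτ : Tendsto (fun h : ℝ => t - ⌊u / h⌋₊ * h) (𝓝[>] 0) (𝓝 (t - u)) :=
          (tendsto_floor_div_mul hu.1.le).const_sub t
        refine ((tendsto_rpow_mul_multichoose_floor hpole hu.1).mul
          (tendsto_iterate_bwdDiff_div hf hτ)).congr' ?_
        filter_upwards [self_mem_nhdsWithin] with η hη
        have := lt_floor_div_add_one_mul t (show 0 < η from hη)
        rw [hF]
        simp only
        rw [indicator_of_mem (show u ∈ Iio _ by push_cast; exact h.trans this)]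
      · rw [hφ, indicator_of_notMem (show u ∉ Iio t from not_lt.2 h.le)]
        refine tendsto_const_nhds.congr' ?_
        filter_upwards [Ioo_mem_nhdsGT (sub_pos.2 h)] with η hη
        have := floor_div_mul_le ht.le hη.1
        rw [hF]
        simp only
        rw [indicator_of_notMem]
        simp only [mem_Iio, not_lt]
        push_cast
        linarith [hη.2]
  have hval : ∫ u in (0 : ℝ)..(t + 1), φ u =
      1 / Real.Gamma β * powConv (β - 1) (iteratedDeriv n f) t := by
    rw [hφ, integral_indicator_Iio ht.le (by linarith), powConv,
      ← intervalIntegral.integral_const_mul]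
    congr 1
    ext u
    ring
  rw [← hval]
  refine hlim.congr' ?_
  filter_upwards [Ioo_mem_nhdsGT (zero_lt_one (α := ℝ))] with h hh
  have hle : ((⌊t / h⌋₊ + 1 : ℕ) : ℝ) * h ≤ t + 1 := by
    have := floor_div_mul_le ht.le hh.1
    push_cast
    linarith [hh.2]
  rw [hF]
  simp only
  rw [integral_indicator_Iio (mul_nonneg (Nat.cast_nonneg _) hh.1.le) hle,
    integral_comp_floor_div hh.1, hG, Finset.mul_sum, Finset.mul_sum]
  refine Finset.sum_congr rfl fun r _ => ?_
  simp only
  rw [Real.rpow_sub_one hh.1.ne']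
  have := hh.1.ne'
  field_simp

/-- After `ord α` summations by parts, the `k`-th boundary term tends to the `k`-th singular term of
`rlDeriv_eq` and the remaining sum to its convolution term. -/
theorem hasGLDerivAt_rlDeriv {α : ℝ} (hα : 0 < α) (hαN : ∀ m : ℕ, α ≠ (m : ℝ)) {g : ℝ → ℝ}
    (hg : ContDiff ℝ (ord α) g) (hB : ∀ k ≤ ord α, ∃ B, ∀ s, |iteratedDeriv k g s| ≤ B)
    {t : ℝ} (ht : 0 < t) : HasGLDerivAt 0 α g (rlDeriv 0 α g t) t := by
  obtain ⟨B, hBn⟩ := hB _ le_rfl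
  -- The boundary differences sit at points of `[-h, 0)`, so they use values of `g` to the left of
  -- the base point.
  have hτ : Tendsto (fun h : ℝ => t - ((⌊t / h⌋₊ : ℝ) + 1) * h) (𝓝[>] 0) (𝓝 0) := by
    have := ((tendsto_floor_div_mul ht.le).add tendsto_id_nhdsGT_zero).const_sub t
    simp only [add_zero, sub_self] at this
    refine this.congr fun h => by ring
  have hbdry : Tendsto (fun h : ℝ => ∑ k ∈ Finset.range (ord α),
      h ^ ((k : ℝ) + 1 - α - 1) * Ring.multichoose ((k : ℝ) + 1 - α) ⌊t / h⌋₊ *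
        ((bwdDiff h)^[k] g (t - ((⌊t / h⌋₊ : ℝ) + 1) * h) / h ^ k)) (𝓝[>] 0)
      (𝓝 (∑ k ∈ Finset.range (ord α),
        t ^ ((k : ℝ) + 1 - α - 1) / Real.Gamma ((k : ℝ) + 1 - α) * iteratedDeriv k g 0)) := by
    refine tendsto_finsetSum _ fun k hk => ?_
    have hk : k ≤ ord α := (Finset.mem_range.1 hk).le
    refine (tendsto_rpow_mul_multichoose_floor (fun m h => hαN (k + 1 + m) ?_) ht).mul
      (tendsto_iterate_bwdDiff_div (hg.of_le (by exact_mod_cast hk)) hτ)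
    push_cast
    linarith
  have hmain := tendsto_sum_multichoose_mul_bwdDiff (β := (ord α : ℝ) - α)
    (by linarith [lt_ord α]) (by linarith [ord_sub_one_lt hα hαN]) hg hBn ht
  have hsum := hbdry.add hmain
  rw [HasGLDerivAt, rlDeriv_eq hαN hg hB ht]
  have hlimeq : ∑ k ∈ Finset.range (ord α), iteratedDeriv k g 0 *
        (t ^ ((k : ℝ) - α) / Real.Gamma ((k : ℝ) + 1 - α)) =
      ∑ k ∈ Finset.range (ord α),
        t ^ ((k : ℝ) + 1 - α - 1) / Real.Gamma ((k : ℝ) + 1 - α) * iteratedDeriv k g 0 := by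
    refine Finset.sum_congr rfl fun k _ => ?_
    rw [show (k : ℝ) + 1 - α - 1 = k - α by ring]
    ring
  rw [hlimeq]
  refine hsum.congr' ?_
  filter_upwards [self_mem_nhdsWithin] with h hh
  have hh : 0 < h := hh
  simp only [glQuotient, sub_zero, neg_one_pow_mul_choose]
  rw [sum_multichoose_mul_bwdDiff (-α) g t h ⌊t / h⌋₊ (ord α), mul_add, Finset.mul_sum,
    Finset.mul_sum, Finset.mul_sum]
  congr 1
  · refine Finset.sum_congr rfl fun k _ => ?_
    rw [show (k : ℝ) + 1 - α - 1 = -α + k by ring, Real.rpow_add_natCast hh.ne',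
      show -α + (k : ℝ) + 1 = k + 1 - α by ring]
    field_simp
  · refine Finset.sum_congr rfl fun r _ => ?_
    rw [show (ord α : ℝ) - α = -α + ord α by ring, Real.rpow_add_natCast hh.ne']
    field_simp

/-! ### Periodic extension to the line and transfer back to the half-line -/

theorem PeriodicOnPos.add_nat_mul {x : ℝ → ℝ} {T : ℝ} (hT : 0 < T) (h : PeriodicOnPos T x)
    (k : ℕ) {t : ℝ} (ht : 0 < t) : x (t + k * T) = x t := by
  induction k with
  | zero => simp
  | succ k ih =>
    rw [← ih, ← h (t + k * T) (by positivity)]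
    congr 1
    push_cast
    ring

theorem PeriodicOnPos.add_nat_mul_eq {x : ℝ → ℝ} {T : ℝ} (hT : 0 < T) (h : PeriodicOnPos T x)
    {k m : ℕ} {t : ℝ} (hk : 0 < t + k * T) (hm : 0 < t + m * T) :
    x (t + k * T) = x (t + m * T) := by
  wlog hkm : k ≤ m generalizing k m
  · exact (this hm hk (le_of_not_ge hkm)).symm
  obtain ⟨d, rfl⟩ := Nat.exists_eq_add_of_le hkm
  rw [← h.add_nat_mul hT d hk]
  congr 1
  push_cast
  ring

/-- A smooth periodic function on `(0, ∞)` extends to a smooth periodic function on `ℝ`. -/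
theorem exists_periodic_extension {n : ℕ} {x : ℝ → ℝ} {T : ℝ} (hT : 0 < T)
    (hx : ContDiffOn ℝ n x (Ioi 0)) (hper : PeriodicOnPos T x) :
    ∃ y : ℝ → ℝ, ContDiff ℝ n y ∧ Function.Periodic y T ∧ EqOn x y (Ioi 0) := by
  have hpos : ∀ t : ℝ, 0 < t + (⌊|t| / T⌋₊ + 1 : ℕ) * T := fun t => by
    have := lt_floor_div_add_one_mul |t| hT
    push_cast
    linarith [neg_abs_le t]
  set y : ℝ → ℝ := fun t => x (t + (⌊|t| / T⌋₊ + 1 : ℕ) * T) with hy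
  have hyk : ∀ (t : ℝ) (k : ℕ), 0 < t + k * T → y t = x (t + k * T) := fun t k hk =>
    hper.add_nat_mul_eq hT (hpos t) hk
  refine ⟨y, contDiff_iff_contDiffAt.2 fun t => ?_, fun t => ?_, fun t ht => ?_⟩
  · set k := ⌊|t| / T⌋₊ + 1 with hk
    -- The number of periods in `y` jumps with `s`, but any shift landing in `(0, ∞)` gives the same
    -- value, so it can be frozen near `t`.
    have heq : y =ᶠ[𝓝 t] fun s => x (s + k * T) := by
      have hc : ContinuousAt (fun s : ℝ => s + k * T) t := by fun_prop
      filter_upwards [hc.eventually (lt_mem_nhds (hpos t))] with s hs using hyk s k hs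
    refine ContDiffAt.congr_of_eventuallyEq ?_ heq
    exact (hx.contDiffAt (Ioi_mem_nhds (hpos t))).comp t
      (f := fun s : ℝ => s + k * T) (by fun_prop)
  · have h1 := hpos t
    rw [hyk t _ h1, hyk (t + T) (⌊|t| / T⌋₊ + 1) (by linarith), ← hper _ h1]
    congr 1
    ring
  · have := hyk t 0 (by simpa using ht)
    simpa using this.symm

theorem kernelIntegral_congr (α : ℝ) {f g : ℝ → ℝ} (h : EqOn f g (Ioi 0)) :
    EqOn (kernelIntegral 0 α f) (kernelIntegral 0 α g) (Ioi 0) := fun t ht => by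
  refine intervalIntegral.integral_congr_ae (Eventually.of_forall fun s hs => ?_)
  rw [uIoc_of_le (le_of_lt ht)] at hs
  rw [h hs.1]

theorem rlDeriv_congr (α : ℝ) {f g : ℝ → ℝ} (h : EqOn f g (Ioi 0)) :
    EqOn (rlDeriv 0 α f) (rlDeriv 0 α g) (Ioi 0) := fun t ht => by
  rw [rlDeriv, rlDeriv, (kernelIntegral_congr α h).iteratedDeriv_of_isOpen isOpen_Ioi _ ht]

theorem caputoDeriv_congr (α : ℝ) {f g : ℝ → ℝ} (h : EqOn f g (Ioi 0)) :
    EqOn (caputoDeriv 0 α f) (caputoDeriv 0 α g) (Ioi 0) := fun t ht => by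
  rw [caputoDeriv, caputoDeriv,
    kernelIntegral_congr α (h.iteratedDeriv_of_isOpen isOpen_Ioi _) ht]

/-- The value of the function at the base point does not affect the limit of the
Grünwald–Letnikov quotients. -/
theorem HasGLDerivAt.congr {α : ℝ} (hαN : ∀ m : ℕ, α ≠ (m : ℝ)) {f g : ℝ → ℝ}
    (h : EqOn f g (Ioi 0)) {L t : ℝ} (ht : 0 < t) (hg : HasGLDerivAt 0 α g L t) :
    HasGLDerivAt 0 α f L t := by
  -- Only the last summand, `r = ⌊t/h⌋₊`, can reach the base point; its coefficient is `O(h)`.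
  have hcoef := (tendsto_rpow_mul_multichoose_floor (s := -α)
    (fun m hm => hαN m (neg_injective hm)) ht).mul tendsto_id_nhdsGT_zero
  rw [mul_zero] at hcoef
  have hbdd : IsBoundedUnder (· ≤ ·) (𝓝[>] (0 : ℝ))
      (norm ∘ fun η : ℝ => f (t - ⌊t / η⌋₊ * η) - g (t - ⌊t / η⌋₊ * η)) := by
    refine isBoundedUnder_of_eventually_le (a := |f 0 - g 0|) ?_
    filter_upwards [self_mem_nhdsWithin] with η hη
    simp only [Function.comp_apply, Real.norm_eq_abs]
    rcases (sub_nonneg.2 (floor_div_mul_le ht.le hη)).eq_or_lt with h0 | h0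
    · rw [← h0]
    · rw [h h0, sub_self, abs_zero]
      exact abs_nonneg _
  have hdiff := hcoef.zero_mul_isBoundedUnder_le hbdd
  have hsum := Tendsto.add hg hdiff
  rw [add_zero] at hsum
  refine hsum.congr' ?_
  filter_upwards [self_mem_nhdsWithin] with η hη
  have hη : 0 < η := hη
  have hmem : ∀ r ∈ Finset.range ⌊t / η⌋₊, f (t - r * η) = g (t - r * η) := by
    intro r hr
    have hr' : (r : ℝ) + 1 ≤ ⌊t / η⌋₊ := by exact_mod_cast Finset.mem_range.1 hr
    refine h (show 0 < t - r * η from ?_)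
    nlinarith [floor_div_mul_le ht.le hη]
  simp only [glQuotient, sub_zero, neg_one_pow_mul_choose, Finset.sum_range_succ]
  rw [Finset.sum_congr rfl fun r hr => by rw [← hmem r hr], Real.rpow_sub_one hη.ne']
  field_simp
  ring

end FracDeriv

open FracDeriv in
theorem corollary1 (α : ℝ) (hα : 0 < α) (hαN : ∀ m : ℕ, α ≠ (m : ℝ))
    (T : ℝ) (hT : 0 < T) (x : ℝ → ℝ)
    (hx : ContDiffOn ℝ (FracDeriv.ord α : ℕ) x (Set.Ioi 0))
    (hper : FracDeriv.PeriodicOnPos T x)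
    (hnc : ∃ s t : ℝ, 0 < s ∧ 0 < t ∧ x s ≠ x t) :
    -- the Riemann–Liouville derivative exists on `(0, ∞)` and is not `T`-periodic
    (ContDiffOn ℝ (FracDeriv.ord α : ℕ) (FracDeriv.kernelIntegral 0 α x) (Set.Ioi 0) ∧
      ¬ FracDeriv.PeriodicOnPos T (FracDeriv.rlDeriv 0 α x)) ∧
    -- the Grünwald–Letnikov derivative exists on `(0, ∞)`, equals the Riemann–Liouville
    -- derivative there, and is not `T`-periodic
    ((∀ t, 0 < t → FracDeriv.HasGLDerivAt 0 α x (FracDeriv.glDeriv 0 α x t) t) ∧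
      (∀ t, 0 < t → FracDeriv.glDeriv 0 α x t = FracDeriv.rlDeriv 0 α x t) ∧
      ¬ FracDeriv.PeriodicOnPos T (FracDeriv.glDeriv 0 α x)) ∧
    -- the limits `c k` of the derivatives of `x` at `0⁺` exist, and they decide between
    -- blow-up at `0⁺` and equality with the Caputo derivative
    (∃ c : ℕ → ℝ,
      (∀ k < FracDeriv.ord α, Tendsto (iteratedDeriv k x) (𝓝[>] 0) (𝓝 (c k))) ∧
      ((∃ k < FracDeriv.ord α, c k ≠ 0) →
        Tendsto (FracDeriv.rlDeriv 0 α x) (𝓝[>] 0) atTop ∨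
        Tendsto (FracDeriv.rlDeriv 0 α x) (𝓝[>] 0) atBot) ∧
      ((∀ k < FracDeriv.ord α, c k = 0) →
        (∀ t, 0 < t → FracDeriv.rlDeriv 0 α x t = FracDeriv.caputoDeriv 0 α x t) ∧
        ¬ FracDeriv.PeriodicOnPos T (FracDeriv.caputoDeriv 0 α x))) := by
  obtain ⟨y, hy, hyper, hxy⟩ := exists_periodic_extension hT hx hper
  have hB := exists_bound_iteratedDeriv hT hyper hy
  have hrl := rlDeriv_congr α hxy
  have hcongr : ∀ {f g : ℝ → ℝ}, (∀ t, 0 < t → f t = g t) → PeriodicOnPos T g →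
      PeriodicOnPos T f := fun h hg t ht => by
    rw [h t ht, h (t + T) (by linarith), hg t ht]
  have hnot : ¬ PeriodicOnPos T (rlDeriv 0 α x) := fun h => by
    obtain ⟨s, t, hs, ht, hne⟩ := hnc
    have hzero := eq_zero_of_periodicOnPos_rlDeriv hα hαN hT hy hyper
      (hcongr (fun t ht => (hrl ht).symm) h)
    rw [hxy hs, hxy ht, hzero, hzero] at hne
    exact hne rfl
  have hgl : ∀ t, 0 < t → HasGLDerivAt 0 α x (rlDeriv 0 α x t) t := fun t ht => by
    rw [hrl ht]
    exact (hasGLDerivAt_rlDeriv hα hαN hy hB ht).congr hαN hxy ht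
  have hgleq : ∀ t, 0 < t → glDeriv 0 α x t = rlDeriv 0 α x t := fun t ht =>
    (hgl t ht).limUnder_eq
  -- The limits at `0⁺` are the derivatives at `0` of the extension `y`.
  refine ⟨⟨(contDiffOn_kernelIntegral hy hB).congr (kernelIntegral_congr α hxy), hnot⟩,
    ⟨fun t ht => by rw [hgleq t ht]; exact hgl t ht, hgleq,
      fun h => hnot (hcongr (fun t ht => (hgleq t ht).symm) h)⟩,
    fun k => iteratedDeriv k y 0, fun k hk => ?_, fun hne => ?_, fun h0 => ?_⟩
  · have hc : Continuous (iteratedDeriv k y) :=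
      hy.continuous_iteratedDeriv k (by exact_mod_cast hk.le)
    refine ((hc.tendsto 0).mono_left nhdsWithin_le_nhds).congr' ?_
    filter_upwards [self_mem_nhdsWithin] with t ht
    exact (hxy.iteratedDeriv_of_isOpen isOpen_Ioi k ht).symm
  · have heq : rlDeriv 0 α y =ᶠ[𝓝[>] 0] rlDeriv 0 α x := by
      filter_upwards [self_mem_nhdsWithin] with t ht using (hrl ht).symm
    exact (tendsto_rlDeriv_atTop_or_atBot hα hαN hy hB hne).imp
      (fun h => h.congr' heq) (fun h => h.congr' heq)
  · have h0 : ∀ k < ord α, iteratedDeriv k y 0 = 0 := h0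
    have hcap : ∀ t, 0 < t → rlDeriv 0 α x t = caputoDeriv 0 α x t := fun t ht => by
      rw [hrl ht, caputoDeriv_congr α hxy ht, rlDeriv_eq hαN hy hB ht, caputoDeriv_eq,
        Finset.sum_eq_zero, zero_add]
      intro k hk
      rw [h0 k (Finset.mem_range.1 hk), zero_mul]
    exact ⟨hcap, fun h => hnot (hcongr hcap h)⟩
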